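/- **Lemma (the cut-off model approximates the realistic model).** Let $n\ge 0$ and $d\ge 1$ be integers, let $E^*\in\mathbb R$, and work on the $n$-mode Hilbert space $L^2(\mathbb R^n)$ with quadratures $\hat q_j$ (multiplication by $x_j$) and $\hat p_j=-i\partial_j$. The energy of a density operator $\hat\rho$ is $E_{\hat\rho}=\mathrm{Tr}(\hat H\hat\rho)$ with $\hat H=\frac12\sum_{j}(\hat q_j^2+\hat p_j^2)$. The elementary gates are * rotations $\hat R_k(\theta)=e^{i\theta(\hat q_k^2+\hat p_k^2)/2}$, * displacements $\hat D_k(r_q,r_p)=e^{i(r_q\hat p_k-r_p\hat q_k)}$, * squeezing gates $\hat S_k(r)=e^{-\frac{ir}{2}(\hat q_k\hat p_k+\hat p_k\hat q_k)}$, * cubic phase gates $\hat C_k(\gamma)=e^{i\gamma\hat q_k^3}$, * Mach–Zehnder interferometers $\hat B_{kl}\hat R_k(2\theta)\hat B_{kl}\hat R_k(\phi)$, where $k\ne l$ and $\hat B_{kl}=e^{i\frac{\pi}{4}(\hat p_k\hat q_l-\hat q_k\hat p_l)}$. Put $\ell=\sqrt{2\pi/d}$. For $\bar{\mathbf x}\in\mathcal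 X^n$ with $\mathcal X=\{\ell(u-\lfloor d/2\rfloor):u=0,\dots,d-1\}$, let $\hat K_{\bar{\mathbf x}}$ be the spectral projector of $\hat{\mathbf q}$ on the bin $\bar{\mathbf x}+(-\ell/2,\ell/2]^n$. Let $\hat\Lambda_d$ be the spectral projector of $\hat{\mathbf q}$ on the window $[-(\lfloor d/2\rfloor+\frac12)\ell,\,(\lceil d/2\rceil-\frac12)\ell]^n$. For a positive trace-class operator $\hat\sigma$ put $$p_{\hat\sigma}(\bar{\mathbf x})=\frac{\mathrm{Tr}(\hat K_{\bar{\mathbf x}}\hat\sigma)}{\mathcal N_{\hat\sigma}},\qquad \mathcal N_{\hat\sigma}=\sum_{\bar{\mathbf x}\in\mathcal X^n}\mathrm{Tr}(\hat K_{\bar{\mathbf x}}\hat\sigma),$$ (with $p_{\hat\sigma}=0$ if $\mathcal N_{\hat\sigma}=0$). Let $\hat\rho$ be a density operator and let $\hat U_1,\dots,\hat U_L$ ($L\ge 0$) be elementary gates such that the input state $\hat\rho$ and the state after each gate have energy at most $E^*$, that is, $E_{\hat U_j\cdots\hat U_1\hat\rho\,\hat U_1^\dagger\cdots\hat U_j^\dagger}\le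 \max(E^*,0)$ for $j=0,\dots,L$. Let $p_R=p_{\hat\sigma}$ with $\hat\sigma=\hat U\hat\rho\hat U^\dagger$, $\hat U=\hat U_L\cdots\hat U_1$, be the outcome distribution of this circuit in the realistic model (RCVQC). Let $p_C=p_{\hat\sigma'}$ with $\hat\sigma'=\hat U'\hat\rho\hat U'^\dagger$, $\hat U'=\hat\Lambda_d\hat U_L\hat\Lambda_d\hat U_{L-1}\cdots\hat\Lambda_d\hat U_1\hat\Lambda_d$, be its outcome distribution in the cut-off model (CCVQC), where $\hat\Lambda_d$ acts before every gate and before the measurement. Then the total variation distance satisfies $$\sup_{A\subseteq\mathcal X^n}|p_R(A)-p_C(A)|\;\le\;2(L+1)\sqrt{\frac{E^*}{d\pi}}$$ (where $\sqrt{t}=0$ for $t<0$; $E^*<0$ is only possible when $n=0$). -/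

import Mathlib

open MeasureTheory
open scoped ENNReal FourierTransform SchwartzMap

noncomputable section

namespace CV

/-- The configuration space `ℝⁿ` of `n` modes. -/
abbrev Config (n : ℕ) : Type := EuclideanSpace ℝ (Fin n)

/-- The Hilbert space `L²(ℝⁿ)` of `n` modes. -/
abbrev ModeSpace (n : ℕ) : Type := Lp ℂ 2 (volume : Measure (Config n))

/-- Bounded operators on `L²(ℝⁿ)`. -/
abbrev Op (n : ℕ) : Type := ModeSpace n →L[ℂ] ModeSpace n

/-- Unitary operators on `L²(ℝⁿ)`. -/
abbrev Unitary (n : ℕ) : Type := ModeSpace n ≃ₗᵢ[ℂ] ModeSpace n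

/-! ### Quadratures and elementary gates -/

/-- The position quadrature `q_j`, as multiplication by the `j`-th coordinate. -/
def qOp {n : ℕ} (j : Fin n) (f : Config n → ℂ) : Config n → ℂ :=
  fun x => ((x j : ℝ) : ℂ) * f x

/-- The momentum quadrature `p_j = -i ∂_j`, so that `[q_k, p_l] = i δ_kl`. -/
def pOp {n : ℕ} (j : Fin n) (f : Config n → ℂ) : Config n → ℂ :=
  fun x => -Complex.I * fderiv ℝ f x (EuclideanSpace.single j 1)

/-- `U = e^{i t G}` where `G` is a differential expression that is essentially self-adjoint on
Schwartz functions: `U` is the value at time `t` of a strongly continuous one-parameter unitary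
group whose derivative at time `0` on every Schwartz function `f` is `i G f`. -/
def IsExpI {n : ℕ} (G : (Config n → ℂ) → (Config n → ℂ)) (t : ℝ) (U : Unitary n) : Prop :=
  ∃ V : ℝ → Unitary n,
    (∀ s s' : ℝ, ∀ ψ : ModeSpace n, V (s + s') ψ = V s (V s' ψ)) ∧
    (∀ ψ : ModeSpace n, Continuous fun s : ℝ => V s ψ) ∧
    (∀ f : 𝓢(Config n, ℂ), ∃ g : ModeSpace n,
      (∀ᵐ x : Config n, g x = Complex.I * G (fun y => f y) x) ∧
      HasDerivAt (fun s : ℝ => V s (f.toLp 2)) g 0) ∧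
    U = V t

/-- The rotation `R_k(θ) = exp (i θ (q_k² + p_k²) / 2)`. -/
def IsRotation {n : ℕ} (k : Fin n) (θ : ℝ) (U : Unitary n) : Prop :=
  IsExpI (fun f x => (qOp k (qOp k f) x + pOp k (pOp k f) x) / 2) θ U

/-- The single-mode displacement `D_k(r_q, r_p) = exp (i (r_q p_k - r_p q_k))`. -/
def IsDisplacement {n : ℕ} (k : Fin n) (rq rp : ℝ) (U : Unitary n) : Prop :=
  IsExpI (fun f x => (rq : ℂ) * pOp k f x - (rp : ℂ) * qOp k f x) 1 U

/-- The squeezing gate `S_k(r) = exp (-(i r / 2) (q_k p_k + p_k q_k))`. -/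
def IsSqueezing {n : ℕ} (k : Fin n) (r : ℝ) (U : Unitary n) : Prop :=
  IsExpI (fun f x => -(qOp k (pOp k f) x + pOp k (qOp k f) x) / 2) r U

/-- The cubic phase gate `C_k(γ) = exp (i γ q_k³)`. -/
def IsCubicPhase {n : ℕ} (k : Fin n) (γ : ℝ) (U : Unitary n) : Prop :=
  IsExpI (fun f x => qOp k (qOp k (qOp k f)) x) γ U

/-- The beam splitter `B_kl(θ) = exp (i θ (p_k q_l - q_k p_l))`. -/
def IsBeamSplitter {n : ℕ} (k l : Fin n) (θ : ℝ) (U : Unitary n) : Prop :=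
  IsExpI (fun f x => pOp k (qOp l f) x - qOp k (pOp l f) x) θ U

/-- The Mach-Zehnder interferometer `B_kl(φ, θ) = B_kl R_k(2θ) B_kl R_k(φ)` where
`B_kl = B_kl(π/4)` is the 50:50 beam splitter. -/
def IsMachZehnder {n : ℕ} (k l : Fin n) (φ θ : ℝ) (U : Unitary n) : Prop :=
  ∃ B R R' : Unitary n,
    IsBeamSplitter k l (Real.pi / 4) B ∧ IsRotation k (2 * θ) R ∧ IsRotation k φ R' ∧
    ∀ ψ : ModeSpace n, U ψ = B (R (B (R' ψ)))

/-- The elementary gates: Mach-Zehnder interferometers, single-mode rotations, displacements,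
squeezing gates and cubic phase gates. -/
def IsElementaryGate {n : ℕ} (U : Unitary n) : Prop :=
  (∃ (k l : Fin n) (φ θ : ℝ), k ≠ l ∧ IsMachZehnder k l φ θ U) ∨
  (∃ (k : Fin n) (θ : ℝ), IsRotation k θ U) ∨
  (∃ (k : Fin n) (rq rp : ℝ), IsDisplacement k rq rp U) ∨
  (∃ (k : Fin n) (r : ℝ), IsSqueezing k r U) ∨
  (∃ (k : Fin n) (γ : ℝ), IsCubicPhase k γ U)

/-! ### Trace, states and energy -/

/-- Index set of a fixed Hilbert basis of `L²(ℝⁿ)`. -/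
def basisIndex (n : ℕ) : Set (ModeSpace n) :=
  (exists_hilbertBasis ℂ (ModeSpace n)).choose

/-- A fixed Hilbert basis of `L²(ℝⁿ)`. -/
def basis (n : ℕ) : HilbertBasis (basisIndex n) ℂ (ModeSpace n) :=
  (exists_hilbertBasis ℂ (ModeSpace n)).choose_spec.choose

/-- The trace `Σ_i ⟨e_i, T e_i⟩` of a trace-class operator (the value does not depend on the
Hilbert basis). -/
def trace {n : ℕ} (T : Op n) : ℂ := ∑' i, inner ℂ (basis n i) (T (basis n i))

/-- Density operators: positive (trace-class) operators of trace one. -/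
def IsDensityOperator {n : ℕ} (ρ : Op n) : Prop :=
  ρ.IsPositive ∧ HasSum (fun i => inner ℂ (basis n i) (ρ (basis n i))) 1

/-- The quadratic form of the Hamiltonian `H = Σ_j (q_j² + p_j²) / 2 = Σ_j (n_j + 1/2)`, with
value `∞` outside the form domain. With the convention `𝓕 ψ ξ = ∫ e^{-2πi ⟨x, ξ⟩} ψ x`, the momentum
`p_j` is multiplication by `2π ξ_j` on the Fourier side. -/
def energyForm {n : ℕ} (ψ : ModeSpace n) : ℝ≥0∞ :=
  ∑ j : Fin n,
    ((∫⁻ x : Config n, ENNReal.ofReal ((x j) ^ 2) * ‖ψ x‖ₑ ^ 2) +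
      ∫⁻ ξ : Config n, ENNReal.ofReal ((2 * Real.pi * ξ j) ^ 2) *
        ‖(𝓕 ψ : ModeSpace n) ξ‖ₑ ^ 2) / 2

/-- The positive square root of a positive bounded operator on a Hilbert space. -/
def opSqrt {H : Type*} [NormedAddCommGroup H] [InnerProductSpace ℂ H] [CompleteSpace H]
    (T : H →L[ℂ] H) : H →L[ℂ] H := CFC.sqrt T

/-- The energy `E_ρ = Tr (H ρ) = Tr (√ρ H √ρ)` of a state. -/
def energy {n : ℕ} (ρ : Op n) : ℝ≥0∞ := ∑' i, energyForm (opSqrt ρ (basis n i))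

/-! ### Position projectors and measurements -/

/-- Multiplication of a square-integrable function by the indicator function of `S`. -/
def mulIndicator {n : ℕ} (S : Set (Config n)) (hS : MeasurableSet S) (ψ : ModeSpace n) :
    ModeSpace n :=
  ((Lp.memLp ψ).indicator hS).toLp (S.indicator ψ)

theorem coeFn_mulIndicator {n : ℕ} (S : Set (Config n)) (hS : MeasurableSet S)
    (ψ : ModeSpace n) : ⇑(mulIndicator S hS ψ) =ᵐ[volume] S.indicator ψ :=
  MemLp.coeFn_toLp _

theorem mulIndicator_add {n : ℕ} (S : Set (Config n)) (hS : MeasurableSet S)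
    (ψ φ : ModeSpace n) :
    mulIndicator S hS (ψ + φ) = mulIndicator S hS ψ + mulIndicator S hS φ := by
  apply Lp.ext
  filter_upwards [coeFn_mulIndicator S hS (ψ + φ), coeFn_mulIndicator S hS ψ,
    coeFn_mulIndicator S hS φ, Lp.coeFn_add ψ φ,
    Lp.coeFn_add (mulIndicator S hS ψ) (mulIndicator S hS φ)] with x h1 h2 h3 h4 h5
  rw [h1, h5, Pi.add_apply, h2, h3]
  by_cases hx : x ∈ S
  · rw [Set.indicator_of_mem hx, Set.indicator_of_mem hx, Set.indicator_of_mem hx, h4,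
      Pi.add_apply]
  · rw [Set.indicator_of_notMem hx, Set.indicator_of_notMem hx, Set.indicator_of_notMem hx,
      add_zero]

theorem mulIndicator_smul {n : ℕ} (S : Set (Config n)) (hS : MeasurableSet S)
    (c : ℂ) (ψ : ModeSpace n) :
    mulIndicator S hS (c • ψ) = c • mulIndicator S hS ψ := by
  apply Lp.ext
  filter_upwards [coeFn_mulIndicator S hS (c • ψ), coeFn_mulIndicator S hS ψ,
    Lp.coeFn_smul c ψ, Lp.coeFn_smul c (mulIndicator S hS ψ)] with x h1 h2 h3 h4
  rw [h1, h4, Pi.smul_apply, h2]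
  by_cases hx : x ∈ S
  · rw [Set.indicator_of_mem hx, Set.indicator_of_mem hx, h3, Pi.smul_apply]
  · rw [Set.indicator_of_notMem hx, Set.indicator_of_notMem hx, smul_zero]

theorem norm_mulIndicator_le {n : ℕ} (S : Set (Config n)) (hS : MeasurableSet S)
    (ψ : ModeSpace n) : ‖mulIndicator S hS ψ‖ ≤ 1 * ‖ψ‖ := by
  rw [one_mul]
  refine Lp.norm_le_norm_of_ae_le ?_
  filter_upwards [coeFn_mulIndicator S hS ψ] with x h1
  rw [h1]
  exact norm_indicator_le_norm_self _ _

/-- The spectral projector `∫_S dx |q = x⟩⟨q = x|` of the position quadratures, that is,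
multiplication by the indicator function of `S`. -/
def posProj {n : ℕ} (S : Set (Config n)) (hS : MeasurableSet S) : Op n :=
  LinearMap.mkContinuous
    { toFun := mulIndicator S hS
      map_add' := mulIndicator_add S hS
      map_smul' := mulIndicator_smul S hS }
    1 (norm_mulIndicator_le S hS)

/-- The bin width `ℓ = √(2π/d)`. -/
def binWidth (d : ℕ) : ℝ := Real.sqrt (2 * Real.pi / d)

/-- The window of the position cut-off,
`[-(⌊d/2⌋ + 1/2) ℓ, (⌈d/2⌉ - 1/2) ℓ]` in every mode. -/
def window (n d : ℕ) : Set (Config n) :=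
  {x | ∀ j, x j ∈ Set.Icc (-((((d / 2 : ℕ) : ℝ) + 1 / 2) * binWidth d))
    (((((d + 1) / 2 : ℕ) : ℝ) - 1 / 2) * binWidth d)}

/-- A measurement outcome `u` stands for the bin centre `x̄` with
`x̄_j = ℓ (u_j - ⌊d/2⌋)`, `u_j ∈ {0, …, d - 1}`. -/
abbrev Outcome (n d : ℕ) : Type := Fin n → Fin d

/-- The bin centre `x̄_j = ℓ (u_j - ⌊d/2⌋)`. -/
def binCentre {n d : ℕ} (u : Outcome n d) (j : Fin n) : ℝ :=
  binWidth d * (((u j : ℕ) : ℝ) - ((d / 2 : ℕ) : ℝ))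

/-- The bin `x̄ + (-ℓ/2, ℓ/2]ⁿ`. -/
def bin {n d : ℕ} (u : Outcome n d) : Set (Config n) :=
  {x | ∀ j, x j - binCentre u j ∈ Set.Ioc (-(binWidth d / 2)) (binWidth d / 2)}

theorem measurableSet_window (n d : ℕ) : MeasurableSet (window n d) := by
  simp only [window, Set.ofPred_forall]
  exact MeasurableSet.iInter fun j =>
    measurableSet_Icc.preimage (by fun_prop : Measurable fun x : Config n => x j)

theorem measurableSet_bin {n d : ℕ} (u : Outcome n d) : MeasurableSet (bin u) := by
  simp only [bin, Set.ofPred_forall]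
  exact MeasurableSet.iInter fun j => measurableSet_Ioc.preimage
    (by fun_prop : Measurable fun x : Config n => x j - binCentre u j)

/-- The cut-off projector `Λ_d`. -/
def cutoff (n d : ℕ) : Op n := posProj (window n d) (measurableSet_window n d)

/-- The measurement operator `K_x̄` of a bin. -/
def binOp {n d : ℕ} (u : Outcome n d) : Op n := posProj (bin u) (measurableSet_bin u)

/-- Outcome probabilities of the binned homodyne measurement of all modes of the (possibly
unnormalised) state `σ`, renormalised after discarding the overflow bin:
`p(x̄) = Tr (K_x̄ σ) / 𝒩` with `𝒩 = Σ_x̄ Tr (K_x̄ σ)`. -/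
def outcomeProb {n : ℕ} (d : ℕ) (σ : Op n) (u : Outcome n d) : ℝ :=
  (trace (binOp u ∘L σ)).re / ∑ v : Outcome n d, (trace (binOp v ∘L σ)).re

/-! ### The two models -/

/-- Conjugation `A σ A†`. -/
def conj {n : ℕ} (A σ : Op n) : Op n := A ∘L σ ∘L A.adjoint

/-- A unitary as a bounded operator. -/
def unitaryOp {n : ℕ} (U : Unitary n) : Op n := U.toContinuousLinearEquiv.toContinuousLinearMap

/-- The state after the gates of the list have been applied, the head of the list first. -/
def evolve {n : ℕ} (ρ : Op n) (gates : List (Unitary n)) : Op n :=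
  gates.foldl (fun σ U => conj (unitaryOp U) σ) ρ

/-- The (unnormalised) state after the gates of the list have been applied, the head of the list
first, with the cut-off projector acting before every gate and once more before the final
measurement: `(Λ U_L Λ ⋯ Λ U_1 Λ) ρ (Λ U_L Λ ⋯ Λ U_1 Λ)†`. -/
def evolveCutoff {n : ℕ} (d : ℕ) (ρ : Op n) (gates : List (Unitary n)) : Op n :=
  conj (cutoff n d) (gates.foldl (fun σ U => conj (unitaryOp U) (conj (cutoff n d) σ)) ρ)

/-- The circuits of the realistic model with energy bound `Emax`: an input state and a sequence of
elementary gates such that the input state and the state after each gate have energy at most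
`Emax`. -/
structure IsRealisticCircuit {n : ℕ} (Emax : ℝ) (ρ : Op n) (gates : List (Unitary n)) : Prop where
  state : IsDensityOperator ρ
  elementary : ∀ U ∈ gates, IsElementaryGate U
  energy_le : ∀ j ≤ gates.length, energy (evolve ρ (gates.take j)) ≤ ENNReal.ofReal Emax

/-- Outcome distribution `p_R` of a circuit in the realistic model. -/
def probRealistic {n : ℕ} (d : ℕ) (ρ : Op n) (gates : List (Unitary n)) : Outcome n d → ℝ :=
  outcomeProb d (evolve ρ gates)

/-- Outcome distribution `p_C` of the same circuit in the cut-off model. -/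
def probCutoff {n : ℕ} (d : ℕ) (ρ : Op n) (gates : List (Unitary n)) : Outcome n d → ℝ :=
  outcomeProb d (evolveCutoff d ρ gates)

/-- Total variation distance `sup_A |p(A) - p'(A)|` on a finite set of outcomes. -/
def tvDist {α : Type*} (p p' : α → ℝ) : ℝ :=
  ⨆ A : Finset α, |∑ x ∈ A, p x - ∑ x ∈ A, p' x|

end CV

end

/-!
Write `Λ` for the cut-off and `v = (√ρ e_i)_i` for a purification of the input state, a unit vector
of `L²(ℝⁿ) ⊗ ℓ²`. The outcome probabilities are the renormalised numbers `‖K_u x‖²` with `x = U_L ⋯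
U_1 v` in the realistic model and `‖K_u y‖²` with `y = U_L Λ ⋯ U_1 Λ v` in the cut-off model; the
last `Λ` can be dropped because every bin lies in the window (`probRealistic_eq`, `probCutoff_eq`).
This rests on two properties of Hilbert–Schmidt operators, invariance of the norm under adjoints
(`tsum_enorm_sq_adjoint`) and cyclicity of the trace (`tsum_inner_projection_comp`).

If each intermediate state has amplitude at most `κ` outside the bins, the triangle inequality gives
`‖x - y‖ ≤ L κ` (`norm_amplify_circuitOp_sub_le`). Renormalised distributions are compared by a
planar estimate, which bounds their distance by `‖x - y‖` over the length of the detected part of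
`x` (`tvDist_normalized_sq_mul_sqrt_le`), so that the total variation distance is at most
`L κ / √(1 - κ²)` (`tvDist_mul_sqrt_le`).

Chebyshev's inequality for the potential energy alone gives `κ² = 2 E / m²`, where `m` is the
distance from the origin to the nearer face of the window (`halfWidth_sq_mul_norm_sq_le`). Put
`ε = 2 √(E / (d π))`; the target is `(L + 1) ε`, which is trivial unless `(L + 1) ε < 1`. For odd
`d` one has `κ = ε`, and replacing `L` by `L + 1` pays for `√(1 - κ²)`. For even `d` the window is
off-centre and only `κ = ε d / (d - 1)` is available. A circuit with no gates (`L = 0`) has the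
same outcomes in both models. For `L ≥ 1` the slack still suffices when `(L + 1)² < 2 d`
(`div_sub_one_sq_mul_le`, `mul_le_mul_sqrt_of_sq_le`), and in the opposite case the zero-point
energy `E ≥ 1 / 2` already makes the target at least one; with no modes (`n = 0`) nothing lies
outside the bins. The zero-point energy comes from the uncertainty relation
(`enorm_sq_le_lintegral_add_lintegral`), proved on the whole form domain by replacing the momentum
with finite differences, which the Fourier transform turns into multiplication by
`e^{2πi⟨a, ξ⟩} - 1`.
-/

noncomputable section

namespace CV

/-! ### Hilbert–Schmidt operators -/

section Hilbert

variable {ι H : Type*} [NormedAddCommGroup H] [InnerProductSpace ℂ H]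

theorem hasSum_norm_sq_inner (b : HilbertBasis ι ℂ H) (x : H) :
    HasSum (fun i => ‖inner ℂ (b i) x‖ ^ 2) (‖x‖ ^ 2) := by
  have h := (b.hasSum_inner_mul_inner x x).mapL Complex.reCLM
  convert h using 1
  · ext i
    rw [← inner_conj_symm x (b i), Complex.reCLM_apply, ← Complex.normSq_eq_conj_mul_self,
      Complex.ofReal_re, Complex.normSq_eq_norm_sq]
  · rw [Complex.reCLM_apply, inner_self_eq_norm_sq_to_K]
    norm_cast

theorem tsum_enorm_sq_inner (b : HilbertBasis ι ℂ H) (x : H) :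
    ∑' i, ‖inner ℂ (b i) x‖ₑ ^ 2 = ‖x‖ₑ ^ 2 := by
  have h := hasSum_norm_sq_inner b x
  have h2 := ENNReal.ofReal_tsum_of_nonneg (fun i => by positivity) h.summable
  rw [h.tsum_eq] at h2
  simpa only [ENNReal.ofReal_pow (norm_nonneg _), ofReal_norm] using h2.symm

theorem summable_norm_sq_inner (b : HilbertBasis ι ℂ H) (T : H →L[ℂ] H)
    (hT : Summable fun k => ‖T (b k)‖ ^ 2) :
    Summable fun p : ι × ι => ‖inner ℂ (b p.2) (T (b p.1))‖ ^ 2 := by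
  rw [summable_prod_of_nonneg fun p => by positivity]
  refine ⟨fun k => (hasSum_norm_sq_inner b (T (b k))).summable, ?_⟩
  simpa only [(hasSum_norm_sq_inner b (T (b _))).tsum_eq] using hT

variable [CompleteSpace H]

/-- The Hilbert–Schmidt norm is invariant under taking adjoints. -/
theorem tsum_enorm_sq_adjoint (b : HilbertBasis ι ℂ H) (T : H →L[ℂ] H) :
    ∑' i, ‖T.adjoint (b i)‖ₑ ^ 2 = ∑' i, ‖T (b i)‖ₑ ^ 2 := by
  simp_rw [← tsum_enorm_sq_inner b (T (b _)), ← tsum_enorm_sq_inner b (T.adjoint (b _))]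
  rw [ENNReal.tsum_comm]
  congr! 4 with i k
  rw [ContinuousLinearMap.adjoint_inner_right, ← inner_conj_symm, RCLike.enorm_conj]

/-- Cyclicity of the trace: `Tr (K T T†) = Tr (T† K K T)` for an orthogonal projection `K` and a
Hilbert–Schmidt operator `T`. -/
theorem tsum_inner_projection_comp (b : HilbertBasis ι ℂ H) (K T : H →L[ℂ] H)
    (hK : K.adjoint = K) (hKK : K ∘L K = K) (hT : Summable fun k => ‖T (b k)‖ ^ 2) :
    (∑' i, inner ℂ (b i) (K (T (T.adjoint (b i))))).re = ∑' k, ‖K (T (b k))‖ ^ 2 := by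
  have hKT : Summable fun k => ‖(K ∘L T) (b k)‖ ^ 2 := by
    refine .of_nonneg_of_le (fun k => by positivity) (fun k => ?_) (hT.mul_left (‖K‖ ^ 2))
    rw [← mul_pow]
    gcongr
    exact K.le_opNorm _
  have hs : Summable fun p : ι × ι =>
      inner ℂ (b p.2) (K (T (b p.1))) * inner ℂ (T (b p.1)) (b p.2) := by
    refine .of_norm_bounded ((summable_norm_sq_inner b _ hKT).add
      (summable_norm_sq_inner b _ hT)) fun p => ?_
    rw [norm_mul, norm_inner_symm (T _)]
    simp only [ContinuousLinearMap.comp_apply]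
    nlinarith [sq_nonneg (‖inner ℂ (b p.2) (K (T (b p.1)))‖ - ‖inner ℂ (b p.2) (T (b p.1))‖),
      sq_nonneg ‖inner ℂ (b p.2) (K (T (b p.1)))‖, sq_nonneg ‖inner ℂ (b p.2) (T (b p.1))‖]
  have h1 (i : ι) : inner ℂ (b i) (K (T (T.adjoint (b i)))) =
      ∑' k, inner ℂ (b i) (K (T (b k))) * inner ℂ (T (b k)) (b i) := by
    rw [← ContinuousLinearMap.comp_apply K T, ← ContinuousLinearMap.adjoint_inner_left,
      ← b.tsum_inner_mul_inner]
    simp only [ContinuousLinearMap.adjoint_inner_left, ContinuousLinearMap.adjoint_inner_right,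
      ContinuousLinearMap.comp_apply]
  have h2 (k : ι) : ∑' i, inner ℂ (b i) (K (T (b k))) * inner ℂ (T (b k)) (b i) =
      ((‖K (T (b k))‖ ^ 2 : ℝ) : ℂ) := by
    simp_rw [mul_comm (inner ℂ (b _) (K (T (b k))))]
    rw [b.tsum_inner_mul_inner]
    nth_rewrite 1 [← hKK]
    rw [ContinuousLinearMap.comp_apply, ← ContinuousLinearMap.adjoint_inner_left, hK,
      inner_self_eq_norm_sq_to_K]
    norm_cast
  simp_rw [h1]
  rw [Summable.tsum_comm (f := fun k i =>
    inner ℂ (b i) (K (T (b k))) * inner ℂ (T (b k)) (b i)) hs]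
  simp_rw [h2]
  rw [← Complex.ofReal_tsum, Complex.ofReal_re]

theorem opSqrt_comp_opSqrt {ρ : H →L[ℂ] H} (hρ : ρ.IsPositive) :
    opSqrt ρ ∘L opSqrt ρ = ρ :=
  CFC.sqrt_mul_sqrt_self ρ (ρ.nonneg_iff_isPositive.mpr hρ)

theorem adjoint_opSqrt (ρ : H →L[ℂ] H) : (opSqrt ρ).adjoint = opSqrt ρ :=
  (IsSelfAdjoint.of_nonneg (CFC.sqrt_nonneg ρ)).star_eq

theorem norm_sq_opSqrt_apply {ρ : H →L[ℂ] H} (hρ : ρ.IsPositive) (x : H) :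
    ‖opSqrt ρ x‖ ^ 2 = (inner ℂ x (ρ x)).re := by
  nth_rewrite 2 [← opSqrt_comp_opSqrt hρ]
  rw [ContinuousLinearMap.comp_apply, ← ContinuousLinearMap.adjoint_inner_left, adjoint_opSqrt,
    inner_self_eq_norm_sq_to_K]
  norm_cast

/-- `‖P √(A ρ A†)‖₂ = ‖P A √ρ‖₂` in the Hilbert–Schmidt norm. -/
theorem tsum_enorm_sq_opSqrt_conj (b : HilbertBasis ι ℂ H) {ρ : H →L[ℂ] H}
    (hρ : ρ.IsPositive) (A P : H →L[ℂ] H) (hP : P.adjoint = P) :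
    ∑' i, ‖P (opSqrt (A ∘L ρ ∘L A.adjoint) (b i))‖ₑ ^ 2 =
      ∑' i, ‖P (A (opSqrt ρ (b i)))‖ₑ ^ 2 := by
  have hσ : (A ∘L ρ ∘L A.adjoint).IsPositive := hρ.conj_adjoint A
  have h1 := tsum_enorm_sq_adjoint b (P ∘L opSqrt (A ∘L ρ ∘L A.adjoint))
  have h2 := tsum_enorm_sq_adjoint b (P ∘L A ∘L opSqrt ρ)
  simp only [ContinuousLinearMap.adjoint_comp, adjoint_opSqrt, hP,
    ContinuousLinearMap.comp_apply] at h1 h2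
  rw [← h1, ← h2]
  congr! 2 with i
  simp only [← ofReal_norm, ← ENNReal.ofReal_pow (norm_nonneg _), norm_sq_opSqrt_apply hσ,
    norm_sq_opSqrt_apply hρ, ContinuousLinearMap.comp_apply,
    ContinuousLinearMap.adjoint_inner_left]

end Hilbert

/-! ### Square-summable families of vectors -/

theorem hasSum_norm_sq {ι H : Type*} [NormedAddCommGroup H] (v : lp (fun _ : ι => H) 2) :
    HasSum (fun i => ‖v i‖ ^ 2) (‖v‖ ^ 2) := by
  simpa using lp.hasSum_norm (p := 2) (by norm_num) v

theorem enorm_sq_lp {ι H : Type*} [NormedAddCommGroup H] (v : lp (fun _ : ι => H) 2) :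
    ‖v‖ₑ ^ 2 = ∑' i, ‖v i‖ₑ ^ 2 := by
  have h := hasSum_norm_sq v
  have h2 := ENNReal.ofReal_tsum_of_nonneg (fun i => sq_nonneg ‖v i‖) h.summable
  rw [h.tsum_eq] at h2
  simpa only [ENNReal.ofReal_pow (norm_nonneg _), ofReal_norm] using h2

section Amplify

variable {ι H : Type*} [NormedAddCommGroup H] [InnerProductSpace ℂ H]

/-- The operator `A ⊗ 1` on `H ⊗ ℓ²(ι)`, whose elements are written as square-summable families
of vectors. -/
def amplify (A : H →L[ℂ] H) (v : lp (fun _ : ι => H) 2) : lp (fun _ : ι => H) 2 :=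
  ⟨fun i => A (v i), by
    refine memℓp_gen (Summable.of_nonneg_of_le (fun i => by positivity) (fun i => ?_)
      (((lp.memℓp v).summable (by norm_num)).mul_left (‖A‖ ^ (2 : ℝ≥0∞).toReal)))
    rw [← Real.mul_rpow (by positivity) (by positivity)]
    gcongr
    exact A.le_opNorm _⟩

@[simp]
theorem amplify_apply (A : H →L[ℂ] H) (v : lp (fun _ : ι => H) 2) (i : ι) :
    amplify A v i = A (v i) := rfl

theorem amplify_sub (A : H →L[ℂ] H) (v w : lp (fun _ : ι => H) 2) :
    amplify A (v - w) = amplify A v - amplify A w := by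
  ext i
  simp

theorem norm_sq_amplify (A : H →L[ℂ] H) (v : lp (fun _ : ι => H) 2) :
    ‖amplify A v‖ ^ 2 = ∑' i, ‖A (v i)‖ ^ 2 :=
  (hasSum_norm_sq (amplify A v)).tsum_eq.symm

theorem norm_amplify_le {A : H →L[ℂ] H} (hA : ∀ x, ‖A x‖ ≤ ‖x‖) (v : lp (fun _ : ι => H) 2) :
    ‖amplify A v‖ ≤ ‖v‖ := by
  refine le_of_sq_le_sq ?_ (norm_nonneg _)
  exact hasSum_le (fun i => by gcongr; exact hA _) (hasSum_norm_sq (amplify A v))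
    (hasSum_norm_sq v)

end Amplify

/-! ### Position projectors -/

variable {n : ℕ}

theorem enorm_sq_eq_lintegral (ψ : ModeSpace n) : ‖ψ‖ₑ ^ 2 = ∫⁻ x, ‖ψ x‖ₑ ^ 2 := by
  have h := eLpNorm_nnreal_pow_eq_lintegral (μ := volume) (f := ψ) (p := 2) two_ne_zero
  simp only [NNReal.coe_ofNat, ENNReal.rpow_ofNat] at h
  rw [Lp.enorm_def, ← h]
  rfl

theorem coeFn_posProj (S : Set (Config n)) (hS : MeasurableSet S) (ψ : ModeSpace n) :
    ⇑(posProj S hS ψ) =ᵐ[volume] S.indicator ψ :=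
  coeFn_mulIndicator S hS ψ

theorem enorm_sq_posProj (S : Set (Config n)) (hS : MeasurableSet S) (ψ : ModeSpace n) :
    ‖posProj S hS ψ‖ₑ ^ 2 = ∫⁻ x in S, ‖ψ x‖ₑ ^ 2 := by
  rw [enorm_sq_eq_lintegral, ← lintegral_indicator hS]
  refine lintegral_congr_ae ?_
  filter_upwards [coeFn_posProj S hS ψ] with x hx
  rw [hx]
  by_cases h : x ∈ S <;> simp [h]

theorem posProj_comp_posProj {S T : Set (Config n)} (hS : MeasurableSet S)
    (hT : MeasurableSet T) (hST : S ⊆ T) : posProj S hS ∘L posProj T hT = posProj S hS := by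
  ext1 ψ
  apply Lp.ext
  filter_upwards [coeFn_posProj S hS ψ, coeFn_posProj T hT ψ,
    coeFn_posProj S hS (posProj T hT ψ)] with x h1 h2 h3
  rw [ContinuousLinearMap.comp_apply, h1, h3]
  by_cases h : x ∈ S
  · simp [h, h2, hST h]
  · simp [h]

theorem adjoint_posProj (S : Set (Config n)) (hS : MeasurableSet S) :
    (posProj S hS).adjoint = posProj S hS := by
  refine ((ContinuousLinearMap.eq_adjoint_iff _ _).mpr fun ψ φ => ?_).symm
  rw [L2.inner_def, L2.inner_def]
  refine integral_congr_ae ?_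
  filter_upwards [coeFn_posProj S hS ψ, coeFn_posProj S hS φ] with x h1 h2
  rw [h1, h2]
  by_cases h : x ∈ S <;> simp [h]

theorem norm_posProj_le (S : Set (Config n)) (hS : MeasurableSet S) (ψ : ModeSpace n) :
    ‖posProj S hS ψ‖ ≤ ‖ψ‖ :=
  (norm_mulIndicator_le S hS ψ).trans_eq (one_mul _)

theorem sub_posProj (S : Set (Config n)) (hS : MeasurableSet S) (ψ : ModeSpace n) :
    ψ - posProj S hS ψ = posProj Sᶜ hS.compl ψ := by
  apply Lp.ext
  filter_upwards [coeFn_posProj S hS ψ, coeFn_posProj Sᶜ hS.compl ψ,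
    Lp.coeFn_sub ψ (posProj S hS ψ)] with x h1 h2 h3
  rw [h2, h3, Pi.sub_apply, h1]
  by_cases h : x ∈ S <;> simp [h]

/-! ### Bins and the window -/

theorem binWidth_pos {d : ℕ} (hd : 1 ≤ d) : 0 < binWidth d := by
  have : (0 : ℝ) < d := by exact_mod_cast hd
  exact Real.sqrt_pos.mpr (by positivity)

theorem pairwise_disjoint_bin {d : ℕ} (hd : 1 ≤ d) :
    Pairwise (Function.onFun Disjoint (bin : Outcome n d → Set (Config n))) := by
  intro u v huv
  refine Set.disjoint_left.mpr fun x hu hv => huv (funext fun j => ?_)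
  obtain ⟨h1, h2⟩ := hu j
  obtain ⟨h3, h4⟩ := hv j
  have hl := binWidth_pos hd
  simp only [binCentre] at h1 h2 h3 h4
  have h5 : ((u j : ℕ) : ℝ) < (v j : ℕ) + 1 := by
    by_contra! h
    nlinarith
  have h6 : ((v j : ℕ) : ℝ) < (u j : ℕ) + 1 := by
    by_contra! h
    nlinarith
  have h5' : (u j : ℕ) < (v j : ℕ) + 1 := by exact_mod_cast h5
  have h6' : (v j : ℕ) < (u j : ℕ) + 1 := by exact_mod_cast h6
  exact Fin.ext (by omega)

/-- The region `⋃ u, bin u` of detected positions. -/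
def detected (n d : ℕ) : Set (Config n) := ⋃ u : Outcome n d, bin u

theorem measurableSet_detected (n d : ℕ) : MeasurableSet (detected n d) :=
  .iUnion measurableSet_bin

theorem bin_subset_window {d : ℕ} (u : Outcome n d) : bin u ⊆ window n d := by
  intro x hx j
  obtain ⟨h1, h2⟩ := hx j
  have hl : 0 ≤ binWidth d := Real.sqrt_nonneg _
  simp only [binCentre] at h1 h2
  have h3 : ((u j : ℕ) : ℝ) + 1 ≤ ((d / 2 : ℕ) : ℝ) + (((d + 1) / 2 : ℕ) : ℝ) := by
    have := (u j).isLt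
    norm_cast
    omega
  have h4 : (0 : ℝ) ≤ ((u j : ℕ) : ℝ) := Nat.cast_nonneg _
  constructor <;> nlinarith

theorem detected_subset_window {d : ℕ} : detected n d ⊆ window n d :=
  Set.iUnion_subset bin_subset_window

/-- The distance `(⌈d/2⌉ - 1/2) ℓ` from the origin to the nearer face of the window. -/
def halfWidth (d : ℕ) : ℝ := ((((d + 1) / 2 : ℕ) : ℝ) - 1 / 2) * binWidth d

theorem halfWidth_pos {d : ℕ} (hd : 1 ≤ d) : 0 < halfWidth d := by
  have h : (1 : ℝ) ≤ (((d + 1) / 2 : ℕ) : ℝ) := by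
    norm_cast
    omega
  exact mul_pos (by linarith) (binWidth_pos hd)

theorem exists_halfWidth_le_of_notMem_detected {d : ℕ} (hd : 1 ≤ d) {x : Config n}
    (hx : x ∉ detected n d) : ∃ j, halfWidth d ≤ |x j| := by
  by_contra! h
  refine hx (Set.mem_iUnion.mpr ?_)
  have hl := binWidth_pos hd
  have hfc : ((d / 2 : ℕ) : ℝ) + (((d + 1) / 2 : ℕ) : ℝ) = d := by
    norm_cast
    omega
  have hcf : (((d + 1) / 2 : ℕ) : ℝ) ≤ ((d / 2 : ℕ) : ℝ) + 1 := by
    norm_cast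
    omega
  -- Rounding `x j / ℓ + ⌊d/2⌋` to the nearest integer, downwards at half-integers, gives `u j`.
  have key (j : Fin n) : ∃ u : Fin d, x j - binWidth d * ((u : ℕ) - ((d / 2 : ℕ) : ℝ)) ∈
      Set.Ioc (-(binWidth d / 2)) (binWidth d / 2) := by
    obtain ⟨h1, h2⟩ := abs_lt.mp (h j)
    set y : ℝ := x j / binWidth d with hy
    have hxy : x j = y * binWidth d := (div_mul_cancel₀ _ hl.ne').symm
    rw [halfWidth, hxy] at h1 h2
    have h2' : y < (((d + 1) / 2 : ℕ) : ℝ) - 1 / 2 := lt_of_mul_lt_mul_right h2 hl.le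
    have h1' : -((((d + 1) / 2 : ℕ) : ℝ) - 1 / 2) < y :=
      lt_of_mul_lt_mul_right (by linarith) hl.le
    set k : ℤ := ⌈y + ((d / 2 : ℕ) : ℝ) - 1 / 2⌉ with hk
    have hk1 : (k : ℝ) < y + ((d / 2 : ℕ) : ℝ) - 1 / 2 + 1 := Int.ceil_lt_add_one _
    have hk2 : y + ((d / 2 : ℕ) : ℝ) - 1 / 2 ≤ k := Int.le_ceil _
    have hk0 : (-1 : ℝ) < k := by linarith
    have hkd : (k : ℝ) < d := by linarith
    have hk0' : 0 ≤ k := by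
      have : (-1 : ℤ) < k := by exact_mod_cast hk0
      omega
    lift k to ℕ using hk0' with m
    have hmd : m < d := by exact_mod_cast hkd
    rw [Int.cast_natCast] at hk1 hk2
    refine ⟨⟨m, hmd⟩, ?_⟩
    constructor <;> simp only [hxy] <;> nlinarith
  choose u hu using key
  exact ⟨u, hu⟩

theorem sum_norm_sq_binOp {d : ℕ} (hd : 1 ≤ d) (ψ : ModeSpace n) :
    ∑ u : Outcome n d, ‖binOp u ψ‖ ^ 2 +
      ‖posProj (detected n d)ᶜ (measurableSet_detected n d).compl ψ‖ ^ 2 = ‖ψ‖ ^ 2 := by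
  have h : ∑ u : Outcome n d, ‖binOp u ψ‖ₑ ^ 2 +
      ‖posProj (detected n d)ᶜ (measurableSet_detected n d).compl ψ‖ₑ ^ 2 = ‖ψ‖ₑ ^ 2 := by
    simp only [binOp, enorm_sq_posProj]
    rw [enorm_sq_eq_lintegral, ← lintegral_add_compl (μ := volume) (fun x => ‖ψ x‖ₑ ^ 2)
      (measurableSet_detected n d)]
    congr 1
    rw [detected, lintegral_iUnion measurableSet_bin (pairwise_disjoint_bin hd), tsum_fintype]
  have h' := congrArg ENNReal.toReal h
  rw [ENNReal.toReal_add (by simp) (by simp),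
    ENNReal.toReal_sum (by simp)] at h'
  simpa using h'

/-- Chebyshev's inequality: a position outside the detected region costs potential energy at
least `halfWidth d ^ 2 / 2`. -/
theorem halfWidth_sq_mul_enorm_sq_le_energyForm {d : ℕ} (hd : 1 ≤ d) (ψ : ModeSpace n) :
    ENNReal.ofReal (halfWidth d ^ 2) *
      ‖posProj (detected n d)ᶜ (measurableSet_detected n d).compl ψ‖ₑ ^ 2 ≤
      2 * energyForm ψ := by
  have hdet := (measurableSet_detected n d).compl
  have hm (j : Fin n) : Measurable fun x : Config n => ENNReal.ofReal ((x j) ^ 2) := by fun_prop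
  have h1 : ENNReal.ofReal (halfWidth d ^ 2) *
      ‖posProj (detected n d)ᶜ hdet ψ‖ₑ ^ 2 ≤
      ∑ j : Fin n, ∫⁻ x : Config n, ENNReal.ofReal ((x j) ^ 2) * ‖ψ x‖ₑ ^ 2 := by
    have hψ : AEMeasurable fun x => ‖ψ x‖ₑ ^ 2 :=
      (Lp.aestronglyMeasurable ψ).enorm.pow_const 2
    have hsum : ∑ j : Fin n, ∫⁻ x : Config n, ENNReal.ofReal ((x j) ^ 2) * ‖ψ x‖ₑ ^ 2 =
        ∫⁻ x : Config n, ∑ j : Fin n, ENNReal.ofReal ((x j) ^ 2) * ‖ψ x‖ₑ ^ 2 :=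
      (lintegral_finsetSum' _ fun j _ => (hm j).aemeasurable.mul hψ).symm
    rw [hsum, enorm_sq_posProj, ← lintegral_const_mul'' _ hψ.restrict]
    refine (lintegral_mono_ae ?_).trans (setLIntegral_le_lintegral (detected n d)ᶜ _)
    filter_upwards [ae_restrict_mem hdet] with x hx
    obtain ⟨j, hj⟩ := exists_halfWidth_le_of_notMem_detected hd hx
    refine le_trans ?_ (Finset.single_le_sum
      (f := fun j => ENNReal.ofReal ((x j) ^ 2) * ‖ψ x‖ₑ ^ 2) (fun _ _ => zero_le)
      (Finset.mem_univ j))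
    dsimp only
    refine mul_le_mul' (ENNReal.ofReal_le_ofReal ?_) le_rfl
    exact sq_le_sq.mpr (by rwa [abs_of_pos (halfWidth_pos hd)])
  refine h1.trans ?_
  rw [energyForm, Finset.mul_sum]
  gcongr with j
  rw [ENNReal.mul_div_cancel two_ne_zero ENNReal.ofNat_ne_top]
  exact le_self_add

/-! ### The uncertainty relation -/

/-- The translation `(shift a ψ)(x) = ψ (x + a)`. -/
def shift (a : Config n) : ModeSpace n →+ ModeSpace n :=
  Lp.compMeasurePreserving (fun x => x + a) (measurePreserving_add_right volume a)

theorem coeFn_shift (a : Config n) (ψ : ModeSpace n) :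
    ⇑(shift a ψ) =ᵐ[volume] fun x => ψ (x + a) :=
  Lp.coeFn_compMeasurePreserving ψ _

theorem norm_shift (a : Config n) (ψ : ModeSpace n) : ‖shift a ψ‖ = ‖ψ‖ :=
  Lp.norm_compMeasurePreserving ψ _

theorem continuous_shift (a : Config n) : Continuous (shift a) :=
  (Lp.isometry_compMeasurePreserving _).continuous

/-- The character `ξ ↦ e^{2πi⟨a, ξ⟩}`. -/
def phase (a : Config n) : Lp ℂ ∞ (volume : Measure (Config n)) :=
  MemLp.toLp (fun ξ => ((Real.fourierChar (inner ℝ a ξ) : Circle) : ℂ))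
    (memLp_top_of_bound (by fun_prop) 1 (.of_forall fun ξ => (Circle.norm_coe _).le))

theorem coeFn_phase_smul (a : Config n) (ψ : ModeSpace n) :
    ⇑(phase a • ψ : ModeSpace n) =ᵐ[volume]
      fun ξ => ((Real.fourierChar (inner ℝ a ξ) : Circle) : ℂ) * ψ ξ := by
  filter_upwards [Lp.coeFn_lpSMul (r := 2) (phase a) ψ, MemLp.coeFn_toLp
    (memLp_top_of_bound (μ := volume) (f := fun ξ : Config n =>
      ((Real.fourierChar (inner ℝ a ξ) : Circle) : ℂ)) (by fun_prop) 1
        (.of_forall fun ξ => (Circle.norm_coe _).le))]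
    with ξ h1 h2
  rw [h1]
  simp only [Pi.smul_apply', smul_eq_mul]
  congr 1

/-- The Fourier transform on `L²` turns translations into multiplication by characters; this is
extended by density from Schwartz functions, where the Fourier integral converges. -/
theorem fourier_shift (a : Config n) (ψ : ModeSpace n) :
    (𝓕 (shift a ψ) : ModeSpace n) = phase a • (𝓕 ψ : ModeSpace n) := by
  refine DenseRange.induction_on
    (p := fun ψ : ModeSpace n => (𝓕 (shift a ψ) : ModeSpace n) = phase a • (𝓕 ψ : ModeSpace n))
    (SchwartzMap.denseRange_toLpCLM (p := 2) ENNReal.ofNat_ne_top) ψ ?_ fun f => ?_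
  · refine isClosed_eq ((Lp.fourierTransformₗᵢ _ ℂ).continuous.comp (continuous_shift a)) ?_
    have hphase : Continuous fun ψ : ModeSpace n => (phase a • ψ : ModeSpace n) := by
      refine (AddMonoidHomClass.continuous_of_bound
        (AddMonoidHom.mk' (fun ψ : ModeSpace n => (phase a • ψ : ModeSpace n))
          fun ψ φ => Lp.add_smul (phase a) ψ φ) ‖phase a‖
        fun ψ => Lp.norm_smul_le (phase a) ψ)
    exact hphase.comp (Lp.fourierTransformₗᵢ _ ℂ).continuous
  · rw [SchwartzMap.toLpCLM_apply]
    have hshift : shift a (f.toLp 2) = (f.compSubConstCLM ℂ (-a)).toLp 2 := by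
      apply Lp.ext
      filter_upwards [coeFn_shift a (f.toLp 2), (f.compSubConstCLM ℂ (-a)).coeFn_toLp 2,
        (measurePreserving_add_right volume a).quasiMeasurePreserving.ae_eq_comp
          (f.coeFn_toLp 2)] with x h1 h2 h3
      rw [h1, h2, SchwartzMap.compSubConstCLM_apply, sub_neg_eq_add]
      exact h3
    rw [hshift, SchwartzMap.toLp_fourier_eq, SchwartzMap.toLp_fourier_eq]
    apply Lp.ext
    filter_upwards [(𝓕 (f.compSubConstCLM ℂ (-a)) : 𝓢(Config n, ℂ)).coeFn_toLp 2,
      coeFn_phase_smul a ((𝓕 f : 𝓢(Config n, ℂ)).toLp 2),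
      (𝓕 f : 𝓢(Config n, ℂ)).coeFn_toLp 2] with ξ h1 h2 h3
    rw [h1, h2, h3, SchwartzMap.fourier_coe, SchwartzMap.fourier_coe]
    have hcomp : ⇑(f.compSubConstCLM ℂ (-a)) = ⇑f ∘ fun x => x + a := by
      ext x
      simp
    rw [hcomp]
    exact congrFun (VectorFourier.fourierIntegral_comp_add_right Real.fourierChar volume
      (innerₗ (Config n)) f a) ξ

/-- The momentum generates translations: `‖(e^{ihp_j} - 1) ψ‖ ≤ |h| ‖p_j ψ‖`. -/
theorem enorm_sq_shift_sub_le (j : Fin n) (h : ℝ) (ψ : ModeSpace n) :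
    ‖shift (EuclideanSpace.single j h) ψ - ψ‖ₑ ^ 2 ≤
      ENNReal.ofReal (h ^ 2) * ∫⁻ ξ : Config n, ENNReal.ofReal ((2 * Real.pi * ξ j) ^ 2) *
        ‖(𝓕 ψ : ModeSpace n) ξ‖ₑ ^ 2 := by
  set a : Config n := EuclideanSpace.single j h
  have hF : ‖shift a ψ - ψ‖ₑ = ‖phase a • (𝓕 ψ : ModeSpace n) - (𝓕 ψ : ModeSpace n)‖ₑ := by
    rw [← fourier_shift]
    have := (Lp.fourierTransformₗᵢ (Config n) ℂ).enorm_map (shift a ψ - ψ)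
    rw [map_sub] at this
    exact this.symm
  rw [hF, enorm_sq_eq_lintegral, ← lintegral_const_mul' _ _ ENNReal.ofReal_ne_top]
  refine lintegral_mono_ae ?_
  filter_upwards [Lp.coeFn_sub (phase a • (𝓕 ψ : ModeSpace n)) (𝓕 ψ : ModeSpace n),
    coeFn_phase_smul a (𝓕 ψ : ModeSpace n)] with ξ h1 h2
  have hbound : ‖((Real.fourierChar (inner ℝ a ξ) : Circle) : ℂ) - 1‖ₑ ≤
      ‖h * (2 * Real.pi * ξ j)‖ₑ := by
    have hin : inner ℝ a ξ = h * ξ j := by simp [a, EuclideanSpace.inner_single_left]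
    have := Real.enorm_exp_I_mul_ofReal_sub_one_le (x := h * (2 * Real.pi * ξ j))
    rw [Real.fourierChar_apply, hin]
    convert this using 4
    push_cast
    ring
  rw [h1, Pi.sub_apply, h2, ← sub_one_mul, enorm_mul, ← mul_assoc,
    ← ENNReal.ofReal_mul (sq_nonneg h), ← mul_pow h, mul_pow]
  rw [← Real.enorm_of_nonneg (sq_nonneg (h * _)), enorm_pow]
  exact mul_le_mul' (pow_le_pow_left' hbound 2) le_rfl

/-- The finite-difference form of the canonical commutation relation `[q_j, p_j] = i`, where
`φ` stands for `q_j ψ`. -/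
theorem re_inner_shift_sub_shift_neg (j : Fin n) (h : ℝ) (ψ φ : ModeSpace n)
    (hφ : ∀ᵐ x : Config n, φ x = ((x j : ℝ) : ℂ) * ψ x) :
    (inner ℂ (shift (EuclideanSpace.single j h) ψ - shift (-EuclideanSpace.single j h) ψ) φ).re =
      -(h * (inner ℂ ψ (shift (EuclideanSpace.single j h) ψ)).re) := by
  set a : Config n := EuclideanSpace.single j h with ha
  have hadj : inner ℂ (shift (-a) ψ) φ = inner ℂ ψ (shift a φ) := by
    rw [L2.inner_def, L2.inner_def, ← integral_add_right_eq_self _ a]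
    refine integral_congr_ae ?_
    filter_upwards [(measurePreserving_add_right volume a).quasiMeasurePreserving.ae
      (coeFn_shift (-a) ψ), coeFn_shift a φ] with x h1 h2
    rw [h1, h2, add_neg_cancel_right]
  have hre (u w : ModeSpace n) : (inner ℂ u w).re = ∫ x, (inner ℂ (u x) (w x)).re := by
    rw [L2.inner_def]
    exact (integral_re (L2.integrable_inner (𝕜 := ℂ) u w)).symm
  have hint (u w : ModeSpace n) : Integrable fun x => (inner ℂ (u x) (w x)).re :=
    (L2.integrable_inner (𝕜 := ℂ) u w).re
  rw [inner_sub_left, hadj, Complex.sub_re, hre, hre, hre, ← integral_sub (hint _ _) (hint _ _),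
    ← neg_mul, ← integral_const_mul]
  refine integral_congr_ae ?_
  filter_upwards [hφ, (measurePreserving_add_right volume a).quasiMeasurePreserving.ae hφ,
    coeFn_shift a φ, coeFn_shift a ψ] with x h1 h2 h3 h4
  have ha' : (x + a) j = x j + h := by simp [ha]
  rw [h3, h2, h1, h4, ha']
  simp only [RCLike.inner_apply, Complex.mul_re, Complex.mul_im, Complex.conj_re, Complex.conj_im,
    Complex.ofReal_re, Complex.ofReal_im]
  ring

/-- The uncertainty relation `⟨q_j² + p_j²⟩ ≥ 1`. -/
theorem enorm_sq_le_lintegral_add_lintegral (j : Fin n) (ψ : ModeSpace n) :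
    ‖ψ‖ₑ ^ 2 ≤ (∫⁻ x : Config n, ENNReal.ofReal ((x j) ^ 2) * ‖ψ x‖ₑ ^ 2) +
      ∫⁻ ξ : Config n, ENNReal.ofReal ((2 * Real.pi * ξ j) ^ 2) *
        ‖(𝓕 ψ : ModeSpace n) ξ‖ₑ ^ 2 := by
  set Q := ∫⁻ x : Config n, ENNReal.ofReal ((x j) ^ 2) * ‖ψ x‖ₑ ^ 2 with hQ
  set P := ∫⁻ ξ : Config n, ENNReal.ofReal ((2 * Real.pi * ξ j) ^ 2) *
        ‖(𝓕 ψ : ModeSpace n) ξ‖ₑ ^ 2 with hP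
  by_cases hQt : Q = ∞
  · simp [hQt]
  by_cases hPt : P = ∞
  · simp [hPt]
  have hsq (x : Config n) : ‖((x j : ℝ) : ℂ) * ψ x‖ₑ ^ 2 =
      ENNReal.ofReal ((x j) ^ 2) * ‖ψ x‖ₑ ^ 2 := by
    rw [enorm_mul, mul_pow, ← Real.enorm_of_nonneg (sq_nonneg (x j)), enorm_pow]
    congr 2
    simp [enorm_eq_nnnorm]
  have hqm : MemLp (fun x : Config n => ((x j : ℝ) : ℂ) * ψ x) 2 := by
    refine ⟨.mul (by fun_prop) (Lp.aestronglyMeasurable ψ), ?_⟩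
    rw [eLpNorm_lt_top_iff_lintegral_rpow_enorm_lt_top two_ne_zero ENNReal.ofNat_ne_top]
    simp only [ENNReal.toReal_ofNat, ENNReal.rpow_ofNat, hsq]
    exact lt_top_iff_ne_top.mpr hQt
  set φ : ModeSpace n := hqm.toLp with hφ
  have hφψ : ∀ᵐ x : Config n, φ x = ((x j : ℝ) : ℂ) * ψ x := hqm.coeFn_toLp
  have hφQ : ‖φ‖ ^ 2 = Q.toReal := by
    have : ‖φ‖ₑ ^ 2 = Q := by
      rw [enorm_sq_eq_lintegral, hQ]
      refine lintegral_congr_ae ?_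
      filter_upwards [hφψ] with x hx
      rw [hx, hsq]
    rw [← this]
    simp
  have hdiff (s : ℝ) : ‖shift (EuclideanSpace.single j s) ψ - ψ‖ ^ 2 ≤ s ^ 2 * P.toReal := by
    have := ENNReal.toReal_mono (by finiteness) (enorm_sq_shift_sub_le j s ψ)
    rw [ENNReal.toReal_mul, ENNReal.toReal_ofReal (sq_nonneg s)] at this
    simpa using this
  -- The commutation relation at step `s`; the term `s ^ 2 / 2 * P` disappears in the limit.
  have hbound (s : ℝ) (hs : 0 < s) :
      ‖ψ‖ ^ 2 ≤ Q.toReal + P.toReal + s ^ 2 / 2 * P.toReal := by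
    have hcomm := re_inner_shift_sub_shift_neg j s ψ φ hφψ
    set u := shift (EuclideanSpace.single j s) ψ with hu
    set w := shift (-EuclideanSpace.single j s) ψ with hw
    have h1 : ‖u - ψ‖ ^ 2 ≤ s ^ 2 * P.toReal := hdiff s
    have h2 : ‖w - ψ‖ ^ 2 ≤ s ^ 2 * P.toReal := by
      have := hdiff (-s)
      have hneg : EuclideanSpace.single j (-s) = -EuclideanSpace.single j s := by
        ext i
        by_cases h : i = j <;> simp [h]
      rwa [hneg, neg_sq] at this
    have h3 : ‖u - w‖ ≤ ‖u - ψ‖ + ‖w - ψ‖ := by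
      rw [norm_sub_rev w]
      exact norm_sub_le_norm_sub_add_norm_sub u ψ w
    have h4 : |(inner ℂ (u - w) φ).re| ≤ ‖u - w‖ * ‖φ‖ :=
      (Complex.abs_re_le_norm _).trans (norm_inner_le_norm _ _)
    have h5 : ‖u - ψ‖ ^ 2 = 2 * ‖ψ‖ ^ 2 - 2 * (inner ℂ ψ u).re := by
      have := norm_sub_sq (𝕜 := ℂ) ψ u
      rw [norm_sub_rev, this, hu, norm_shift]
      simp only [RCLike.re_to_complex]
      ring
    rw [hcomm, abs_neg, abs_mul, abs_of_pos hs] at h4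
    have h6 := le_abs_self (inner ℂ ψ u).re
    have h7 : s ^ 2 * (2 * |(inner ℂ ψ u).re|) ≤ s ^ 2 * (2 * Q.toReal + 2 * P.toReal) := by
      have h9 : ‖u - w‖ ^ 2 ≤ 4 * (s ^ 2 * P.toReal) := by
        nlinarith [norm_nonneg (u - w), sq_nonneg (‖u - ψ‖ - ‖w - ψ‖)]
      have h10 := mul_le_mul_of_nonneg_left h4 hs.le
      nlinarith [sq_nonneg (2 * (s * ‖φ‖) - ‖u - w‖)]
    have h8 := le_of_mul_le_mul_left h7 (by positivity)
    linarith
  have hreal : ‖ψ‖ ^ 2 ≤ Q.toReal + P.toReal := by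
    have hlim : Filter.Tendsto (fun s : ℝ => Q.toReal + P.toReal + s ^ 2 / 2 * P.toReal)
        (nhdsWithin 0 (Set.Ioi 0)) (nhds (Q.toReal + P.toReal)) := by
      refine tendsto_nhdsWithin_of_tendsto_nhds ?_
      have : Continuous fun s : ℝ => Q.toReal + P.toReal + s ^ 2 / 2 * P.toReal := by fun_prop
      simpa using this.tendsto 0
    exact ge_of_tendsto hlim (by filter_upwards [self_mem_nhdsWithin] with s hs using hbound s hs)
  rw [← ENNReal.toReal_le_toReal (by finiteness) (by finiteness), ENNReal.toReal_add hQt hPt]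
  simpa using hreal

theorem enorm_sq_le_two_mul_energyForm (hn : 1 ≤ n) (ψ : ModeSpace n) :
    ‖ψ‖ₑ ^ 2 ≤ 2 * energyForm ψ := by
  rw [energyForm, Finset.mul_sum]
  refine le_trans ?_ (Finset.single_le_sum (fun _ _ => zero_le) (Finset.mem_univ (⟨0, hn⟩ : Fin n)))
  rw [ENNReal.mul_div_cancel two_ne_zero ENNReal.ofNat_ne_top]
  exact enorm_sq_le_lintegral_add_lintegral _ ψ

/-! ### Total variation distance of renormalised distributions -/

theorem tvDist_le {α : Type*} {p q : α → ℝ} {C : ℝ}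
    (h : ∀ A : Finset α, |∑ x ∈ A, p x - ∑ x ∈ A, q x| ≤ C) : tvDist p q ≤ C :=
  ciSup_le h

theorem sum_div_sum_mem_Icc {α : Type*} [Fintype α] {f : α → ℝ} (hf : ∀ u, 0 ≤ f u)
    (A : Finset α) : ∑ u ∈ A, f u / ∑ v, f v ∈ Set.Icc (0 : ℝ) 1 := by
  rw [← Finset.sum_div]
  refine ⟨div_nonneg (Finset.sum_nonneg fun u _ => hf u) (Finset.sum_nonneg fun u _ => hf u),
    div_le_one_of_le₀ ?_ (Finset.sum_nonneg fun u _ => hf u)⟩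
  exact Finset.sum_le_sum_of_subset_of_nonneg (Finset.subset_univ A) fun u _ _ => hf u

theorem tvDist_div_sum_le_one {α : Type*} [Fintype α] {f g : α → ℝ} (hf : ∀ u, 0 ≤ f u)
    (hg : ∀ u, 0 ≤ g u) :
    tvDist (fun u => f u / ∑ v, f v) (fun u => g u / ∑ v, g v) ≤ 1 := by
  refine tvDist_le fun A => ?_
  obtain ⟨h1, h2⟩ := sum_div_sum_mem_Icc hf A
  obtain ⟨h3, h4⟩ := sum_div_sum_mem_Icc hg A
  exact abs_le.mpr ⟨by linarith, by linarith⟩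

/-- In the plane, the squared cosines of two vectors `a`, `b` with the first axis differ by at most
the sine of the angle between them, hence by at most `‖a - b‖ / ‖a‖`. -/
theorem abs_sq_div_sub_sq_div_mul_sqrt_le (a₀ a₁ b₀ b₁ : ℝ) :
    |a₀ ^ 2 / (a₀ ^ 2 + a₁ ^ 2) - b₀ ^ 2 / (b₀ ^ 2 + b₁ ^ 2)| * √(a₀ ^ 2 + a₁ ^ 2) ≤
      √((a₀ - b₀) ^ 2 + (a₁ - b₁) ^ 2) := by
  rw [← Real.sqrt_sq_eq_abs, ← Real.sqrt_mul (sq_nonneg _)]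
  refine Real.sqrt_le_sqrt ?_
  rcases eq_or_ne (a₀ ^ 2 + a₁ ^ 2) 0 with hS | hS
  · rw [hS, mul_zero]
    positivity
  have hS' : 0 < a₀ ^ 2 + a₁ ^ 2 := lt_of_le_of_ne (by positivity) hS.symm
  rcases eq_or_ne (b₀ ^ 2 + b₁ ^ 2) 0 with hT | hT
  · have h0 : b₀ = 0 := by nlinarith
    have h1 : b₁ = 0 := by nlinarith
    rw [hT, h0, h1, div_zero, sub_zero, sub_zero, sub_zero, div_pow, div_mul_eq_mul_div,
      div_le_iff₀ (by positivity)]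
    nlinarith [mul_nonneg (sq_nonneg a₀) (sq_nonneg a₁), sq_nonneg (a₁ ^ 2),
      mul_nonneg (mul_nonneg (sq_nonneg a₀) (sq_nonneg a₁)) hS'.le,
      mul_nonneg (sq_nonneg (a₁ ^ 2)) hS'.le]
  have hT' : 0 < b₀ ^ 2 + b₁ ^ 2 := lt_of_le_of_ne (by positivity) hT.symm
  have hc : (a₀ * b₁ - b₀ * a₁) ^ 2 ≤
      (b₀ ^ 2 + b₁ ^ 2) * ((a₀ - b₀) ^ 2 + (a₁ - b₁) ^ 2) := by
    nlinarith [sq_nonneg (b₀ * (a₀ - b₀) + b₁ * (a₁ - b₁))]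
  have hs : (a₀ * b₁ + b₀ * a₁) ^ 2 ≤ (a₀ ^ 2 + a₁ ^ 2) * (b₀ ^ 2 + b₁ ^ 2) := by
    nlinarith [sq_nonneg (a₀ * b₀ - a₁ * b₁)]
  have hdiff : a₀ ^ 2 / (a₀ ^ 2 + a₁ ^ 2) - b₀ ^ 2 / (b₀ ^ 2 + b₁ ^ 2) =
      (a₀ * b₁ - b₀ * a₁) * (a₀ * b₁ + b₀ * a₁) /
        ((a₀ ^ 2 + a₁ ^ 2) * (b₀ ^ 2 + b₁ ^ 2)) := by
    rw [div_sub_div _ _ hS hT]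
    ring
  rw [hdiff, div_pow, mul_pow, div_mul_eq_mul_div, div_le_iff₀ (by positivity)]
  have := mul_le_mul hc hs (sq_nonneg _) (by positivity)
  calc _ ≤ (b₀ ^ 2 + b₁ ^ 2) * ((a₀ - b₀) ^ 2 + (a₁ - b₁) ^ 2) *
        ((a₀ ^ 2 + a₁ ^ 2) * (b₀ ^ 2 + b₁ ^ 2)) * (a₀ ^ 2 + a₁ ^ 2) := by gcongr
    _ = _ := by ring

theorem sq_sqrt_sub_sqrt_le {α : Type*} (A : Finset α) (a b : α → ℝ) :
    (√(∑ u ∈ A, a u ^ 2) - √(∑ u ∈ A, b u ^ 2)) ^ 2 ≤ ∑ u ∈ A, (a u - b u) ^ 2 := by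
  have h := Real.sum_mul_le_sqrt_mul_sqrt A a b
  simp only [sub_sq, Finset.sum_add_distrib, Finset.sum_sub_distrib]
  rw [Real.sq_sqrt (Finset.sum_nonneg fun _ _ => sq_nonneg _),
    Real.sq_sqrt (Finset.sum_nonneg fun _ _ => sq_nonneg _)]
  have h2 : ∑ u ∈ A, 2 * a u * b u = 2 * ∑ u ∈ A, a u * b u := by
    simp only [Finset.mul_sum, mul_assoc]
  linarith

/-- Renormalising the squares of the components of two amplitude vectors `a` and `b` gives
distributions at total variation distance at most `‖a - b‖ / ‖a‖`. -/
theorem tvDist_normalized_sq_mul_sqrt_le {α : Type*} [Fintype α] (a b : α → ℝ) :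
    tvDist (fun u => a u ^ 2 / ∑ v, a v ^ 2) (fun u => b u ^ 2 / ∑ v, b v ^ 2) *
      √(∑ u, a u ^ 2) ≤ √(∑ u, (a u - b u) ^ 2) := by
  classical
  rcases (Real.sqrt_nonneg (∑ u, a u ^ 2)).eq_or_lt with h0 | h0
  · rw [← h0, mul_zero]
    positivity
  rw [← le_div_iff₀ h0]
  refine tvDist_le fun A => (le_div_iff₀ h0).mpr ?_
  have hsq (B : Finset α) (f : α → ℝ) : √(∑ u ∈ B, f u ^ 2) ^ 2 = ∑ u ∈ B, f u ^ 2 :=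
    Real.sq_sqrt (Finset.sum_nonneg fun _ _ => sq_nonneg _)
  have h := abs_sq_div_sub_sq_div_mul_sqrt_le (√(∑ u ∈ A, a u ^ 2))
    (√(∑ u ∈ Aᶜ, a u ^ 2)) (√(∑ u ∈ A, b u ^ 2)) (√(∑ u ∈ Aᶜ, b u ^ 2))
  simp only [hsq, Finset.sum_add_sum_compl] at h
  rw [← Finset.sum_div, ← Finset.sum_div]
  refine h.trans (Real.sqrt_le_sqrt ?_)
  rw [← Finset.sum_add_sum_compl A fun u => (a u - b u) ^ 2]
  exact add_le_add (sq_sqrt_sub_sqrt_le A a b) (sq_sqrt_sub_sqrt_le Aᶜ a b)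

/-! ### Purified evolution of the two models -/

/-- The product `U_L ⋯ U_1` of the gates of a circuit. -/
def circuitOp (gates : List (Unitary n)) : Op n :=
  gates.foldl (fun X U => unitaryOp U ∘L X) (.id ℂ _)

/-- The product `U_L Λ ⋯ U_1 Λ` of the gates of a circuit, each preceded by the cut-off. -/
def cutoffCircuitOp (d : ℕ) (gates : List (Unitary n)) : Op n :=
  gates.foldl (fun X U => unitaryOp U ∘L cutoff n d ∘L X) (.id ℂ _)

theorem conj_conj (A B σ : Op n) : conj A (conj B σ) = conj (A ∘L B) σ := by
  simp only [conj, ContinuousLinearMap.adjoint_comp, ContinuousLinearMap.comp_assoc]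

theorem conj_id (σ : Op n) : conj (.id ℂ _) σ = σ := by
  simp [conj, ContinuousLinearMap.adjoint_id]

theorem evolve_eq_conj (ρ : Op n) (gates : List (Unitary n)) :
    evolve ρ gates = conj (circuitOp gates) ρ := by
  induction gates using List.reverseRecOn with
  | nil => exact (conj_id ρ).symm
  | append_singleton l U ih =>
    simp only [evolve, circuitOp, List.foldl_append, List.foldl_cons, List.foldl_nil] at ih ⊢
    rw [ih, conj_conj]

theorem evolveCutoff_eq_conj (d : ℕ) (ρ : Op n) (gates : List (Unitary n)) :
    evolveCutoff d ρ gates = conj (cutoff n d ∘L cutoffCircuitOp d gates) ρ := by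
  rw [evolveCutoff, ← conj_conj]
  congr 1
  induction gates using List.reverseRecOn with
  | nil => exact (conj_id ρ).symm
  | append_singleton l U ih =>
    simp only [cutoffCircuitOp, List.foldl_append, List.foldl_cons, List.foldl_nil] at ih ⊢
    rw [ih, conj_conj, conj_conj, ContinuousLinearMap.comp_assoc]

theorem norm_unitaryOp_apply (U : Unitary n) (ψ : ModeSpace n) : ‖unitaryOp U ψ‖ = ‖ψ‖ :=
  U.norm_map ψ

theorem norm_circuitOp_apply (gates : List (Unitary n)) (ψ : ModeSpace n) :
    ‖circuitOp gates ψ‖ = ‖ψ‖ := by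
  induction gates using List.reverseRecOn with
  | nil => rfl
  | append_singleton l U ih =>
    simp only [circuitOp, List.foldl_append, List.foldl_cons, List.foldl_nil] at ih ⊢
    rw [← ih]
    exact norm_unitaryOp_apply U _

theorem hasSum_norm_sq_opSqrt {ρ : Op n} (hρ : IsDensityOperator ρ) :
    HasSum (fun i => ‖opSqrt ρ (basis n i)‖ ^ 2) 1 := by
  have h := hρ.2.mapL Complex.reCLM
  simpa only [norm_sq_opSqrt_apply hρ.1, Complex.reCLM_apply, Complex.one_re] using h

/-- The vector `(√ρ e_i)_i` in `L²(ℝⁿ) ⊗ ℓ²`, a purification of the state `ρ`. -/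
def purification (ρ : Op n) (hρ : IsDensityOperator ρ) :
    lp (fun _ : basisIndex n => ModeSpace n) 2 :=
  ⟨fun i => opSqrt ρ (basis n i),
    memℓp_gen (by simpa using (hasSum_norm_sq_opSqrt hρ).summable)⟩

theorem norm_purification (ρ : Op n) (hρ : IsDensityOperator ρ) : ‖purification ρ hρ‖ = 1 := by
  have h := (hasSum_norm_sq (purification ρ hρ)).unique (hasSum_norm_sq_opSqrt hρ)
  nlinarith [norm_nonneg (purification ρ hρ)]

theorem re_trace_binOp_conj {d : ℕ} (u : Outcome n d) (A ρ : Op n) (hρ : IsDensityOperator ρ) :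
    (trace (binOp u ∘L conj A ρ)).re =
      ‖amplify (binOp u) (amplify A (purification ρ hρ))‖ ^ 2 := by
  have hT : Summable fun k => ‖(A ∘L opSqrt ρ) (basis n k)‖ ^ 2 :=
    (hasSum_norm_sq (amplify A (purification ρ hρ))).summable
  have h := tsum_inner_projection_comp (basis n) (binOp u) (A ∘L opSqrt ρ)
    (adjoint_posProj _ _) (posProj_comp_posProj _ _ subset_rfl) hT
  have hconj : conj A ρ = (A ∘L opSqrt ρ) ∘L (A ∘L opSqrt ρ).adjoint := by
    nth_rewrite 1 [conj, ← opSqrt_comp_opSqrt hρ.1]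
    simp only [ContinuousLinearMap.adjoint_comp, adjoint_opSqrt, ContinuousLinearMap.comp_assoc]
  rw [norm_sq_amplify, trace, hconj]
  exact h

theorem outcomeProb_conj {d : ℕ} (A ρ : Op n) (hρ : IsDensityOperator ρ) :
    outcomeProb d (conj A ρ) = fun u =>
      ‖amplify (binOp u) (amplify A (purification ρ hρ))‖ ^ 2 /
        ∑ v : Outcome n d, ‖amplify (binOp v) (amplify A (purification ρ hρ))‖ ^ 2 := by
  ext u
  simp only [outcomeProb, re_trace_binOp_conj _ _ _ hρ]

theorem probRealistic_eq {d : ℕ} (ρ : Op n) (hρ : IsDensityOperator ρ)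
    (gates : List (Unitary n)) : probRealistic d ρ gates = fun u =>
      ‖amplify (binOp u) (amplify (circuitOp gates) (purification ρ hρ))‖ ^ 2 /
        ∑ v : Outcome n d,
          ‖amplify (binOp v) (amplify (circuitOp gates) (purification ρ hρ))‖ ^ 2 := by
  rw [probRealistic, evolve_eq_conj, outcomeProb_conj]

/-- The last cut-off does not affect the measurement, because all bins lie in the window. -/
theorem probCutoff_eq {d : ℕ} (ρ : Op n) (hρ : IsDensityOperator ρ)
    (gates : List (Unitary n)) : probCutoff d ρ gates = fun u =>
      ‖amplify (binOp u) (amplify (cutoffCircuitOp d gates) (purification ρ hρ))‖ ^ 2 /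
        ∑ v : Outcome n d,
          ‖amplify (binOp v) (amplify (cutoffCircuitOp d gates) (purification ρ hρ))‖ ^ 2 := by
  have h (u : Outcome n d) (w : lp (fun _ : basisIndex n => ModeSpace n) 2) :
      amplify (binOp u) (amplify (cutoff n d ∘L cutoffCircuitOp d gates) w) =
        amplify (binOp u) (amplify (cutoffCircuitOp d gates) w) := by
    ext1
    funext i
    exact DFunLike.congr_fun (posProj_comp_posProj (measurableSet_bin u)
      (measurableSet_window n d) (bin_subset_window u)) (cutoffCircuitOp d gates (w i))
  rw [probCutoff, evolveCutoff_eq_conj, outcomeProb_conj _ _ hρ]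
  simp only [h]

/-- The projector onto the undetected positions. -/
def lossOp (n d : ℕ) : Op n :=
  posProj (detected n d)ᶜ (measurableSet_detected n d).compl

theorem sum_norm_sq_amplify_binOp {d : ℕ} (hd : 1 ≤ d)
    (v : lp (fun _ : basisIndex n => ModeSpace n) 2) :
    ∑ u : Outcome n d, ‖amplify (binOp u) v‖ ^ 2 + ‖amplify (lossOp n d) v‖ ^ 2 = ‖v‖ ^ 2 := by
  have h := (hasSum_sum fun (u : Outcome n d) (_ : u ∈ Finset.univ) =>
    hasSum_norm_sq (amplify (binOp u) v)).add (hasSum_norm_sq (amplify (lossOp n d) v))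
  simp only [amplify_apply, lossOp, sum_norm_sq_binOp hd] at h
  exact h.unique (hasSum_norm_sq v)

theorem norm_sub_cutoff_le {d : ℕ} (ψ : ModeSpace n) :
    ‖ψ - cutoff n d ψ‖ ≤ ‖lossOp n d ψ‖ := by
  have hW : MeasurableSet (window n d)ᶜ := (measurableSet_window n d).compl
  rw [cutoff, sub_posProj, ← posProj_comp_posProj hW (measurableSet_detected n d).compl
    (Set.compl_subset_compl.mpr detected_subset_window)]
  exact norm_posProj_le _ hW (lossOp n d ψ)

/-- Each cut-off moves the purified state by at most the amplitude outside the detected region,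
and these errors add up. -/
theorem norm_amplify_circuitOp_sub_le {d : ℕ} (gates : List (Unitary n)) {κ : ℝ}
    (v : lp (fun _ : basisIndex n => ModeSpace n) 2)
    (hκ : ∀ j ≤ gates.length, ‖amplify (lossOp n d) (amplify (circuitOp (gates.take j)) v)‖ ≤ κ) :
    ‖amplify (circuitOp gates) v - amplify (cutoffCircuitOp d gates) v‖ ≤ gates.length * κ := by
  induction gates using List.reverseRecOn with
  | nil => simp [circuitOp, cutoffCircuitOp]
  | append_singleton l U ih =>
    have ih' := ih fun j hj => by
      simpa [List.take_append_of_le_length hj] using hκ j (by simp; omega)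
    have hl : ‖amplify (lossOp n d) (amplify (circuitOp l) v)‖ ≤ κ := by
      simpa using hκ l.length (by simp)
    set x := amplify (circuitOp l) v with hx
    set y := amplify (cutoffCircuitOp d l) v with hy
    have hxU : amplify (circuitOp (l ++ [U])) v = amplify (unitaryOp U) x := by
      ext1
      funext i
      simp [circuitOp, hx]
    have hyU : amplify (cutoffCircuitOp d (l ++ [U])) v =
        amplify (unitaryOp U) (amplify (cutoff n d) y) := by
      ext1
      funext i
      simp [cutoffCircuitOp, hy]
    have h1 : ‖x - amplify (cutoff n d) x‖ ≤ ‖amplify (lossOp n d) x‖ := by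
      refine le_of_sq_le_sq ?_ (norm_nonneg _)
      exact hasSum_le (fun i => by
        have := norm_sub_cutoff_le (d := d) (x i)
        simpa using pow_le_pow_left₀ (norm_nonneg _) this 2)
        (hasSum_norm_sq (x - amplify (cutoff n d) x)) (hasSum_norm_sq (amplify (lossOp n d) x))
    have h2 : ‖amplify (cutoff n d) (x - y)‖ ≤ l.length * κ :=
      (norm_amplify_le (norm_posProj_le _ _) _).trans ih'
    have h3 : x - amplify (cutoff n d) y =
        (x - amplify (cutoff n d) x) + amplify (cutoff n d) (x - y) := by
      rw [amplify_sub, sub_add_sub_cancel]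
    have h4 : ‖x - amplify (cutoff n d) y‖ ≤ κ + l.length * κ := by
      rw [h3]
      exact (norm_add_le (x - amplify (cutoff n d) x) (amplify (cutoff n d) (x - y))).trans
        (add_le_add (h1.trans hl) h2)
    rw [hxU, hyU, ← amplify_sub, List.length_append, List.length_singleton]
    have h5 := norm_amplify_le (fun ψ => (norm_unitaryOp_apply U ψ).le) (x - amplify (cutoff n d) y)
    refine h5.trans (h4.trans_eq ?_)
    push_cast
    ring

theorem tvDist_mul_sqrt_le {d : ℕ} (hd : 1 ≤ d) {ρ : Op n} (hρ : IsDensityOperator ρ)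
    (gates : List (Unitary n)) {κ : ℝ}
    (hκ : ∀ j ≤ gates.length, ‖amplify (lossOp n d)
      (amplify (circuitOp (gates.take j)) (purification ρ hρ))‖ ≤ κ) :
    tvDist (probRealistic d ρ gates) (probCutoff d ρ gates) * √(1 - κ ^ 2) ≤
      gates.length * κ := by
  rw [probRealistic_eq ρ hρ, probCutoff_eq ρ hρ]
  set v := purification ρ hρ with hv
  set x := amplify (circuitOp gates) v with hx
  set y := amplify (cutoffCircuitOp d gates) v with hy
  have hx1 : ‖x‖ = 1 := by
    rw [← norm_purification ρ hρ]
    refine (sq_eq_sq₀ (norm_nonneg _) (norm_nonneg _)).mp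
      ((hasSum_norm_sq x).unique ?_)
    simpa [hx, norm_circuitOp_apply] using hasSum_norm_sq v
  have hsum := sum_norm_sq_amplify_binOp hd x
  have hloss : ‖amplify (lossOp n d) x‖ ≤ κ := by simpa using hκ gates.length le_rfl
  have hdev : √(∑ u : Outcome n d, (‖amplify (binOp u) x‖ - ‖amplify (binOp u) y‖) ^ 2) ≤
      gates.length * κ := by
    refine le_trans ?_ (norm_amplify_circuitOp_sub_le gates v hκ)
    refine Real.sqrt_le_iff.mpr ⟨norm_nonneg _, ?_⟩
    rw [← sum_norm_sq_amplify_binOp hd (x - y)]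
    refine le_add_of_le_of_nonneg (Finset.sum_le_sum fun u _ => ?_) (sq_nonneg _)
    rw [amplify_sub]
    exact sq_le_sq.mpr ((abs_norm_sub_norm_le _ _).trans (le_abs_self _))
  refine le_trans ?_ ((tvDist_normalized_sq_mul_sqrt_le (fun u : Outcome n d =>
    ‖amplify (binOp u) x‖) (fun u => ‖amplify (binOp u) y‖)).trans hdev)
  gcongr
  · exact Real.iSup_nonneg fun A => abs_nonneg _
  · rw [hx1] at hsum
    nlinarith [norm_nonneg (amplify (lossOp n d) x)]

/-! ### Energy bounds -/

/-- The mixed-state form of Chebyshev's inequality. -/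
theorem halfWidth_sq_mul_enorm_sq_le_energy {d : ℕ} (hd : 1 ≤ d) {ρ : Op n}
    (hρ : IsDensityOperator ρ) (A : Op n) :
    ENNReal.ofReal (halfWidth d ^ 2) *
      ‖amplify (lossOp n d) (amplify A (purification ρ hρ))‖ₑ ^ 2 ≤ 2 * energy (conj A ρ) := by
  have h := tsum_enorm_sq_opSqrt_conj (basis n) hρ.1 A (lossOp n d) (adjoint_posProj _ _)
  have h2 : ‖amplify (lossOp n d) (amplify A (purification ρ hρ))‖ₑ ^ 2 =
      ∑' i, ‖lossOp n d (opSqrt (conj A ρ) (basis n i))‖ₑ ^ 2 :=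
    (enorm_sq_lp _).trans h.symm
  rw [h2, energy, ← ENNReal.tsum_mul_left, ← ENNReal.tsum_mul_left]
  exact ENNReal.tsum_le_tsum fun i => halfWidth_sq_mul_enorm_sq_le_energyForm hd _

theorem halfWidth_sq_mul_norm_sq_le {d : ℕ} (hd : 1 ≤ d) {ρ : Op n}
    (hρ : IsDensityOperator ρ) (A : Op n) {E : ℝ}
    (hE : energy (conj A ρ) ≤ ENNReal.ofReal E) :
    halfWidth d ^ 2 * ‖amplify (lossOp n d) (amplify A (purification ρ hρ))‖ ^ 2 ≤
      2 * max E 0 := by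
  have h := ENNReal.toReal_mono (by finiteness)
    ((halfWidth_sq_mul_enorm_sq_le_energy hd hρ A).trans (mul_le_mul_right hE 2))
  rw [ENNReal.toReal_mul, ENNReal.toReal_ofReal (sq_nonneg _), ENNReal.toReal_mul,
    ENNReal.toReal_ofReal'] at h
  simpa using h

/-- The zero-point energy: every state of at least one mode has energy at least `1 / 2`. -/
theorem one_half_le_of_energy_le (hn : 1 ≤ n) {ρ : Op n} (hρ : IsDensityOperator ρ) {E : ℝ}
    (hE : energy ρ ≤ ENNReal.ofReal E) : 1 / 2 ≤ E := by
  have h1 : (1 : ℝ≥0∞) ≤ 2 * energy ρ := by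
    have h2 := enorm_sq_lp (purification ρ hρ)
    rw [← ofReal_norm, norm_purification, ENNReal.ofReal_one, one_pow] at h2
    rw [h2, energy, ← ENNReal.tsum_mul_left]
    exact ENNReal.tsum_le_tsum fun i => enorm_sq_le_two_mul_energyForm hn _
  have h := ENNReal.toReal_mono (by finiteness) (h1.trans (mul_le_mul_right hE 2))
  rw [ENNReal.toReal_mul, ENNReal.toReal_ofReal'] at h
  simp only [ENNReal.toReal_one, ENNReal.toReal_ofNat] at h
  rcases max_choice E 0 with h3 | h3 <;> rw [h3] at h <;> linarith

theorem energy_eq_zero_of_no_modes (ρ : Op 0) : energy ρ = 0 := by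
  simp [energy, energyForm]

/-! ### Odd and even numbers of bins -/

/-- For odd `d` the half-width is `d ℓ / 2`, and `ℓ² = 2π / d`. -/
theorem halfWidth_sq_of_odd {d : ℕ} (hodd : Odd d) : halfWidth d ^ 2 = d * Real.pi / 2 := by
  obtain ⟨k, rfl⟩ := hodd
  have h : (2 * k + 1 + 1) / 2 = k + 1 := by omega
  have hk : ((2 * k + 1 : ℕ) : ℝ) ≠ 0 := by positivity
  rw [halfWidth, binWidth, mul_pow, Real.sq_sqrt (by positivity), h]
  push_cast at hk ⊢
  field_simp
  ring

theorem halfWidth_sq_of_even {d : ℕ} (hd : 1 ≤ d) (heven : Even d) :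
    halfWidth d ^ 2 = (d - 1) ^ 2 * Real.pi / (2 * d) := by
  obtain ⟨k, rfl⟩ := heven
  have h : (k + k + 1) / 2 = k := by omega
  have hk : (k : ℝ) ≠ 0 := by
    norm_cast
    omega
  rw [halfWidth, binWidth, mul_pow, Real.sq_sqrt (by positivity), h]
  push_cast
  field_simp
  ring

/-- The slack between `L` and `L + 1` absorbs both the renormalisation factor `√(1 - κ²)` and a
widening `κ = r ε` of the tail amplitude `ε`. -/
theorem mul_le_mul_sqrt_of_sq_le {L ε r : ℝ} (hL : 0 ≤ L) (hε : 0 ≤ ε)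
    (h1 : (L + 1) * ε < 1) (hr2 : r ^ 2 * (L ^ 2 + 1) ≤ (L + 1) ^ 2) :
    L * (r * ε) ≤ (L + 1) * ε * √(1 - (r * ε) ^ 2) ∧ (r * ε) ^ 2 < 1 := by
  have h2 : ((L + 1) * ε) ^ 2 < 1 := by
    have : 0 ≤ (L + 1) * ε := by positivity
    nlinarith
  have h3 : (r * ε) ^ 2 * (L + 1) ^ 2 ≤ r ^ 2 := by
    nlinarith [mul_le_mul_of_nonneg_left h2.le (sq_nonneg r)]
  have h4 : (r * ε) ^ 2 < 1 := by
    have h5 : (r * ε) ^ 2 * (L ^ 2 + 1) ≤ ((L + 1) * ε) ^ 2 := by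
      nlinarith [mul_le_mul_of_nonneg_right hr2 (sq_nonneg ε)]
    nlinarith [mul_nonneg (sq_nonneg (r * ε)) (sq_nonneg L)]
  refine ⟨?_, h4⟩
  refine le_of_sq_le_sq ?_ (by positivity)
  rw [mul_pow _ (√_), Real.sq_sqrt (by linarith)]
  have h6 : (L * r) ^ 2 ≤ (L + 1) ^ 2 * (1 - (r * ε) ^ 2) := by nlinarith
  nlinarith [mul_le_mul_of_nonneg_right h6 (sq_nonneg ε)]

/-- The widening factor `r = d / (d - 1)` of an even number of bins is harmless once
`(L + 1)² < 2 d`. -/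
theorem div_sub_one_sq_mul_le {d L : ℕ} (heven : Even d) (hL : 1 ≤ L)
    (h : (L + 1) ^ 2 < 2 * d) :
    ((d : ℝ) / (d - 1)) ^ 2 * ((L : ℝ) ^ 2 + 1) ≤ ((L : ℝ) + 1) ^ 2 := by
  have hd : 4 ≤ d ∧ L + 2 ≤ d := by
    have : 3 ≤ d := by nlinarith
    have h4 : 4 ≤ d := by
      obtain ⟨k, rfl⟩ := heven
      omega
    refine ⟨h4, ?_⟩
    rcases Nat.lt_or_ge L 3 with h3 | h3
    · omega
    · nlinarith
  obtain ⟨t, rfl⟩ := Nat.exists_eq_add_of_le hd.2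
  have hd1 : ((L + 2 + t : ℕ) : ℝ) - 1 = L + 1 + t := by
    push_cast
    ring
  have hL' : (1 : ℝ) ≤ L := by exact_mod_cast hL
  have ht : (0 : ℝ) ≤ t := t.cast_nonneg
  rw [hd1, div_pow, div_mul_eq_mul_div, div_le_iff₀ (by positivity)]
  push_cast
  rcases hL.eq_or_lt with h1 | h1
  · subst h1
    have ht1 : (1 : ℝ) ≤ t := by
      norm_cast
      omega
    push_cast
    nlinarith
  · have hL2 : (2 : ℝ) ≤ L := by exact_mod_cast h1
    have h2 : (0 : ℝ) ≤ t * (2 * L ^ 2 + 4 * L - 2) := mul_nonneg ht (by nlinarith)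
    have h3 : (0 : ℝ) ≤ 2 * L * t ^ 2 := by positivity
    nlinarith

end CV

end

theorem mainTheorem4 (n d : ℕ) (hd : 1 ≤ d) (Emax : ℝ) (ρ : CV.Op n)
    (gates : List (CV.Unitary n)) (h : CV.IsRealisticCircuit Emax ρ gates) :
    CV.tvDist (CV.probRealistic d ρ gates) (CV.probCutoff d ρ gates) ≤
      2 * ((gates.length : ℝ) + 1) * Real.sqrt (Emax / (d * Real.pi)) := by
  obtain ⟨hρ, -, hE⟩ := h
  have hdpos : (0 : ℝ) < d := by exact_mod_cast hd
  set L := gates.length with hL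
  set ε := 2 * √(Emax / (d * Real.pi)) with hε
  have hε0 : 0 ≤ ε := by positivity
  have hgoal : 2 * ((L : ℝ) + 1) * √(Emax / (d * Real.pi)) = (L + 1) * ε := by
    rw [hε]
    ring
  have hεsq : ε ^ 2 = 4 * max Emax 0 / (d * Real.pi) := by
    have hmax : √(Emax / (d * Real.pi)) = √(max Emax 0 / (d * Real.pi)) := by
      rcases le_total 0 Emax with h0 | h0
      · rw [max_eq_left h0]
      · rw [max_eq_right h0, zero_div, Real.sqrt_zero]
        exact Real.sqrt_eq_zero_of_nonpos (div_nonpos_of_nonpos_of_nonneg h0 (by positivity))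
    rw [hε, hmax, mul_pow, Real.sq_sqrt (by positivity)]
    ring
  rw [hgoal]
  -- A circuit without gates is the same in both models.
  rcases Nat.eq_zero_or_pos L with hL0 | hLpos
  · have hnil : gates = [] := List.length_eq_zero_iff.mp hL0
    rw [CV.probRealistic_eq ρ hρ, CV.probCutoff_eq ρ hρ, hnil]
    refine CV.tvDist_le fun A => ?_
    simp only [CV.circuitOp, CV.cutoffCircuitOp, List.foldl_nil, sub_self, abs_zero]
    positivity
  -- A bound of at least one is trivial.
  by_cases htriv : 1 ≤ (L + 1) * ε
  · rw [CV.probRealistic_eq ρ hρ, CV.probCutoff_eq ρ hρ]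
    exact (CV.tvDist_div_sum_le_one (fun u => sq_nonneg _) fun u => sq_nonneg _).trans htriv
  push Not at htriv
  have hm := CV.halfWidth_pos hd
  have hloss (j : ℕ) (hj : j ≤ L) : CV.halfWidth d ^ 2 *
      ‖CV.amplify (CV.lossOp n d)
        (CV.amplify (CV.circuitOp (gates.take j)) (CV.purification ρ hρ))‖ ^ 2 ≤
      2 * max Emax 0 :=
    CV.halfWidth_sq_mul_norm_sq_le hd hρ _ ((CV.evolve_eq_conj ρ _) ▸ hE j hj)
  suffices hr : ∃ r : ℝ, 0 ≤ r ∧ r ^ 2 * ((L : ℝ) ^ 2 + 1) ≤ ((L : ℝ) + 1) ^ 2 ∧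
      ∀ j ≤ L, ‖CV.amplify (CV.lossOp n d)
        (CV.amplify (CV.circuitOp (gates.take j)) (CV.purification ρ hρ))‖ ^ 2 ≤
        (r * ε) ^ 2 by
    obtain ⟨r, hr0, hr1, hr2⟩ := hr
    have htv := CV.tvDist_mul_sqrt_le hd hρ gates
      fun j hj => le_of_sq_le_sq (hr2 j hj) (mul_nonneg hr0 hε0)
    obtain ⟨h1, h2⟩ := CV.mul_le_mul_sqrt_of_sq_le (Nat.cast_nonneg L) hε0 htriv hr1
    exact le_of_mul_le_mul_right (htv.trans h1) (Real.sqrt_pos.mpr (by linarith))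
  -- Without modes the energy vanishes, and so does the amplitude outside the bins.
  rcases Nat.eq_zero_or_pos n with rfl | hn
  · refine ⟨0, le_rfl, by rw [zero_pow two_ne_zero, zero_mul]; positivity, fun j hj => ?_⟩
    have h0 := CV.halfWidth_sq_mul_norm_sq_le hd hρ (CV.circuitOp (gates.take j)) (E := 0)
      (by simp [CV.energy_eq_zero_of_no_modes])
    rw [max_self, mul_zero] at h0
    rw [zero_mul, zero_pow two_ne_zero]
    exact nonpos_of_mul_nonpos_right h0 (by positivity)
  have hEhalf : 1 / 2 ≤ Emax := CV.one_half_le_of_energy_le hn hρ (hE 0 (Nat.zero_le _))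
  rw [max_eq_left (by linarith)] at hεsq
  rw [max_eq_left (by linarith)] at hloss
  rcases Nat.even_or_odd d with hev | hodd
  · have hd2 : (2 : ℝ) ≤ d := by
      obtain ⟨k, rfl⟩ := hev
      norm_cast
      omega
    have hd1 : (d : ℝ) - 1 ≠ 0 := by linarith
    -- The zero-point energy makes the bound trivial unless `(L + 1)² < 2 d`.
    have hsmall : (L + 1) ^ 2 < 2 * d := by
      have h1 : (((L : ℝ) + 1) * ε) ^ 2 < 1 := by
        have : 0 ≤ ((L : ℝ) + 1) * ε := by positivity
        nlinarith
      rw [mul_pow, hεsq, mul_div_assoc', div_lt_one (by positivity)] at h1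
      have h2 : ((L : ℝ) + 1) ^ 2 * 2 < 2 * d * 2 := by
        nlinarith [Real.pi_lt_four, sq_nonneg ((L : ℝ) + 1)]
      have h3 : ((L : ℝ) + 1) ^ 2 < 2 * d := by linarith
      exact_mod_cast h3
    refine ⟨d / (d - 1), div_nonneg (by linarith) (by linarith),
      CV.div_sub_one_sq_mul_le hev hLpos hsmall, fun j hj => ?_⟩
    refine le_of_mul_le_mul_left ((hloss j hj).trans_eq ?_) (pow_pos hm 2)
    rw [CV.halfWidth_sq_of_even hd hev, mul_pow, hεsq]
    field_simp
    ring
  · refine ⟨1, zero_le_one, by nlinarith [(Nat.cast_nonneg L : (0 : ℝ) ≤ L)], fun j hj => ?_⟩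
    refine le_of_mul_le_mul_left ((hloss j hj).trans_eq ?_) (pow_pos hm 2)
    rw [CV.halfWidth_sq_of_odd hodd, one_mul, hεsq]
    field_simp
    ring
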